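/- Let $\mathcal{G}=(G^0,\mathcal{G}^1,r,s)$ be an arbitrary ultragraph, that is, $G^0$ and $\mathcal{G}^1$ are sets (of any cardinality), $s:\mathcal{G}^1\to G^0$ is a map and $r$ is a map from $\mathcal{G}^1$ to the nonempty subsets of $G^0$. Let $\mathcal{G}^0$ be the smallest family of subsets of $G^0$ that contains $\emptyset$, all singletons $\{v\}$ ($v\in G^0$) and all ranges $r(e)$ ($e\in\mathcal{G}^1$), and is closed under binary unions and intersections. Let $R$ be a unital commutative ring without zero divisors. The Leavitt path algebra $L_R(\mathcal{G})$ is the universal associative (not necessarily unital) $R$-algebra with generators $\{s_e,s_e^*:e\in\mathcal{G}^1\}\cup\{p_A:A\in\mathcal{G}^0\}$ and relations 1. $p_\emptyset=0$, $p_Ap_B=p_{A\cap B}$ and $p_{A\cup B}=p_A+p_B-p_{A\cap B}$ for all $A,B\in\mathcal{G}^0$; 2. $p_{s(e)}s_e=s_ep_{r(e)}=s_e$ and $p_{r(e)}s_e^*=s_e^*p_{s(e)}=s_e^*$ for all $e\in\mathcal{G}^1$; 3. $s_e^*s_f=\delta_{e,f}\,p_{r(e)}$ for all $e,f\in\mathcal{G}^1$;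 4. $p_v=\sum_{s(e)=v}s_es_e^*$ for every $v\in G^0$ with $0<|s^{-1}(v)|<\infty$, where $p_v:=p_{\{v\}}$. Then $L_R(\mathcal{G})$ is semiprime: every two-sided ideal $I$ of $L_R(\mathcal{G})$ with $I^2=0$ is zero. -/

import Mathlib

universe u v w

/-- An ultragraph with vertex set `V` and edge set `E`: each edge has a source vertex and a
nonempty set of vertices as its range. -/
structure Ultragraph (V : Type u) (E : Type v) where
  source : E → V
  range : E → Set V
  range_nonempty : ∀ e, (range e).Nonempty

namespace Ultragraph

variable {V : Type u} {E : Type v}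

/-- Membership in the smallest family of subsets of `V` that contains the singletons and the
ranges of the edges and is closed under finite unions (the empty union included) and finite
nonempty intersections. -/
inductive IsGeneralizedVertex (G : Ultragraph V E) : Set V → Prop
  | singleton (x : V) : IsGeneralizedVertex G {x}
  | range (e : E) : IsGeneralizedVertex G (G.range e)
  | empty : IsGeneralizedVertex G ∅
  | union {A B : Set V} : IsGeneralizedVertex G A → IsGeneralizedVertex G B →
      IsGeneralizedVertex G (A ∪ B)
  | inter {A B : Set V} : IsGeneralizedVertex G A → IsGeneralizedVertex G B →
      IsGeneralizedVertex G (A ∩ B)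

/-- The symbols that generate the Leavitt path algebra: `s_e`, `s_e^*` for edges `e`, and `p_A`
for generalized vertices `A`. -/
inductive Generator (G : Ultragraph V E) : Type (max u v)
  | edge (e : E) : Generator G
  | ghost (e : E) : Generator G
  | proj (A : Set V) (hA : G.IsGeneralizedVertex A) : Generator G

variable (R : Type w) [CommRing R]

/-- The free (associative, not necessarily unital) `R`-algebra on the generators: the semigroup
algebra of the free semigroup. -/
abbrev FreeAlg (G : Ultragraph V E) : Type (max u v w) :=
  MonoidAlgebra R (FreeSemigroup G.Generator)

/-- A generator as an element of the free algebra. -/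
noncomputable def gen (G : Ultragraph V E) (x : G.Generator) : FreeAlg R G :=
  MonoidAlgebra.single (FreeSemigroup.of x) 1

/-- The generator `s_e`. -/
noncomputable def freeS (G : Ultragraph V E) (e : E) : FreeAlg R G := gen R G (.edge e)

/-- The generator `s_e^*`. -/
noncomputable def freeSStar (G : Ultragraph V E) (e : E) : FreeAlg R G := gen R G (.ghost e)

/-- The generator `p_A`. -/
noncomputable def freeP (G : Ultragraph V E) (A : Set V) (hA : G.IsGeneralizedVertex A) :
    FreeAlg R G := gen R G (.proj A hA)

/-- The defining relations of the Leavitt path algebra. -/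
inductive Rel (G : Ultragraph V E) : FreeAlg R G → FreeAlg R G → Prop
  | proj_empty : Rel G (freeP R G ∅ .empty) 0
  | proj_mul (A B : Set V) (hA : G.IsGeneralizedVertex A) (hB : G.IsGeneralizedVertex B) :
      Rel G (freeP R G A hA * freeP R G B hB) (freeP R G (A ∩ B) (.inter hA hB))
  | proj_union (A B : Set V) (hA : G.IsGeneralizedVertex A) (hB : G.IsGeneralizedVertex B) :
      Rel G (freeP R G (A ∪ B) (.union hA hB))
        (freeP R G A hA + freeP R G B hB - freeP R G (A ∩ B) (.inter hA hB))
  | source_edge (e : E) :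
      Rel G (freeP R G {G.source e} (.singleton _) * freeS R G e) (freeS R G e)
  | edge_range (e : E) :
      Rel G (freeS R G e * freeP R G (G.range e) (.range e)) (freeS R G e)
  | range_ghost (e : E) :
      Rel G (freeP R G (G.range e) (.range e) * freeSStar R G e) (freeSStar R G e)
  | ghost_source (e : E) :
      Rel G (freeSStar R G e * freeP R G {G.source e} (.singleton _)) (freeSStar R G e)
  | ghost_edge_same (e : E) :
      Rel G (freeSStar R G e * freeS R G e) (freeP R G (G.range e) (.range e))
  | ghost_edge_ne (e f : E) (hef : e ≠ f) :
      Rel G (freeSStar R G e * freeS R G f) 0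
  | vertex_sum (x : V) (hfin : {e : E | G.source e = x}.Finite)
      (hne : {e : E | G.source e = x}.Nonempty) :
      Rel G (freeP R G {x} (.singleton x)) (∑ e ∈ hfin.toFinset, freeS R G e * freeSStar R G e)

/-- The `R`-multiples of the defining relations. In an algebra without unit the ring congruence
generated by the relations alone need not be stable under scalars. -/
inductive ScaledRel (G : Ultragraph V E) : FreeAlg R G → FreeAlg R G → Prop
  | mk (r : R) {a b : FreeAlg R G} : Rel R G a b → ScaledRel G (r • a) (r • b)

/-- The `R`-algebra congruence generated by the defining relations. -/
noncomputable def leavittCon (G : Ultragraph V E) : RingCon (FreeAlg R G) :=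
  ringConGen (ScaledRel R G)

/-- The Leavitt path algebra `L_R(G)`: the universal (not necessarily unital) `R`-algebra on the
generators `s_e`, `s_e^*`, `p_A` subject to the defining relations. -/
def LeavittPathAlgebra (G : Ultragraph V E) : Type (max u v w) :=
  (leavittCon R G).Quotient

noncomputable instance (G : Ultragraph V E) : NonUnitalRing (LeavittPathAlgebra R G) :=
  inferInstanceAs (NonUnitalRing (leavittCon R G).Quotient)

theorem leavittCon_smul (G : Ultragraph V E) (r : R) {a b : FreeAlg R G}
    (h : leavittCon R G a b) : leavittCon R G (r • a) (r • b) := by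
  have key : ∀ a b : FreeAlg R G, RingConGen.Rel (ScaledRel R G) a b →
      leavittCon R G (r • a) (r • b) ∧ leavittCon R G a b := by
    intro a b h
    induction h with
    | of x y h =>
      refine ⟨?_, RingConGen.Rel.of _ _ h⟩
      obtain ⟨t, h⟩ := h
      rw [smul_smul, smul_smul]
      exact RingConGen.Rel.of _ _ ⟨r * t, h⟩
    | refl x => exact ⟨(leavittCon R G).refl _, (leavittCon R G).refl _⟩
    | symm _ ih => exact ⟨(leavittCon R G).symm ih.1, (leavittCon R G).symm ih.2⟩
    | trans _ _ ih₁ ih₂ =>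
      exact ⟨(leavittCon R G).trans ih₁.1 ih₂.1, (leavittCon R G).trans ih₁.2 ih₂.2⟩
    | add _ _ ih₁ ih₂ =>
      refine ⟨?_, (leavittCon R G).add ih₁.2 ih₂.2⟩
      rw [smul_add, smul_add]
      exact (leavittCon R G).add ih₁.1 ih₂.1
    | mul _ _ ih₁ ih₂ =>
      refine ⟨?_, (leavittCon R G).mul ih₁.2 ih₂.2⟩
      rw [← smul_mul_assoc, ← smul_mul_assoc]
      exact (leavittCon R G).mul ih₁.1 ih₂.2
  exact (key a b h).1

/-- The quotient map from the free algebra. -/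
noncomputable def leavittMk (G : Ultragraph V E) (a : FreeAlg R G) : LeavittPathAlgebra R G :=
  (a : (leavittCon R G).Quotient)

theorem leavittMk_surjective (G : Ultragraph V E) : Function.Surjective (leavittMk R G) :=
  Quotient.mk''_surjective

noncomputable instance (G : Ultragraph V E) : SMul R (LeavittPathAlgebra R G) where
  smul r := Quotient.map' (r • ·) fun _ _ h => leavittCon_smul R G r h

/-- The `R`-algebra structure on `L_R(G)`, together with the next two instances. -/
noncomputable instance (G : Ultragraph V E) : Module R (LeavittPathAlgebra R G) :=
  fast_instance% Function.Surjective.module R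
    ({ toFun := leavittMk R G, map_zero' := rfl, map_add' := fun _ _ => rfl } :
      FreeAlg R G →+ LeavittPathAlgebra R G) (leavittMk_surjective R G) fun _ _ => rfl

instance (G : Ultragraph V E) :
    IsScalarTower R (LeavittPathAlgebra R G) (LeavittPathAlgebra R G) where
  smul_assoc r x y := by
    obtain ⟨a, rfl⟩ := leavittMk_surjective R G x
    obtain ⟨b, rfl⟩ := leavittMk_surjective R G y
    exact congrArg (leavittMk R G) (smul_mul_assoc r a b)

instance (G : Ultragraph V E) :
    SMulCommClass R (LeavittPathAlgebra R G) (LeavittPathAlgebra R G) where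
  smul_comm r x y := by
    obtain ⟨a, rfl⟩ := leavittMk_surjective R G x
    obtain ⟨b, rfl⟩ := leavittMk_surjective R G y
    exact congrArg (leavittMk R G) (mul_smul_comm r a b).symm

end Ultragraph

/-- The product `I * J` of two-sided ideals: all finite sums of products `x * y` with `x` in `I`
and `y` in `J`. -/
def TwoSidedIdeal.productSubgroup {A : Type*} [NonUnitalRing A] (I J : TwoSidedIdeal A) :
    AddSubgroup A :=
  AddSubgroup.closure {z | ∃ x ∈ I, ∃ y ∈ J, z = x * y}

/-- A ring (not necessarily unital) is semiprime if every two-sided ideal `I` with `I ^ 2 = 0`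
is zero. -/
def IsSemiprimeRing (A : Type*) [NonUnitalRing A] : Prop :=
  ∀ I : TwoSidedIdeal A, I.productSubgroup I = ⊥ → I = ⊥

/-!
The Leavitt path algebra embeds in its unitization, where it is spanned by the elements
`s_α p_A s_β^*`; their degree is `|α| - |β|`.

The algebraic half of the proof compresses a nonzero homogeneous element `a` to a vertex: there are
`t`, `s` with `t a s = r p_v` and `r ≠ 0`. Multiplying `a` by edges on the right shortens its ghost
paths. If all `a s_e` vanish, the relation `∑ s_e s_e^* = p_v` at regular vertices shows that the
ghost-free part of `a` must already be visible at some vertex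
(`exists_compress_of_forall_mul_S_eq_zero`), and the remaining real paths are removed by multiplying
by ghost edges on the left. What is left is a combination of projections `p_A`, and such a
combination is zero as soon as its product with each `p_v` is zero (`eq_zero_of_forall_mul_pv`).

The other half is a representation showing that the multiples of `p_v` by nonzero scalars are
nonzero and of degree exactly zero. It acts on functions on `X × ℤ`, where `X` is a branching system
made of equinumerous sets over the vertices (`exists_branchingSystem`), and the factor `ℤ` provides
a filtration by degree.

Now let `x ≠ 0` lie in an ideal of square zero, so that `x u x = 0` for all `u`. Compressing the
component of top degree of `x` turns `x` into `c = r p_v + b` with `b` of negative degree and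
`c ^ 2 = 0`. Hence `r ^ 2 p_v` has negative degree, so `r ^ 2 = 0`, and `r = 0` because `R` has no
zero divisors (`DegreeFiltration.eq_zero_of_forall_mul_mul_eq_zero`).
-/

namespace Ultragraph

/-! ### Families of elements satisfying the Leavitt relations -/

/-- A family of elements `S e`, `T e`, `P A` of a unital ring that satisfies the defining
relations of the Leavitt path algebra, with `T e` in the role of `s_e^*`. -/
structure LeavittFamily {V : Type*} {E : Type*} (G : Ultragraph V E) (U : Type*) [Ring U] where
  S : E → U
  T : E → U
  P : ∀ A : Set V, G.IsGeneralizedVertex A → U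
  P_empty : P ∅ .empty = 0
  P_mul : ∀ (A B : Set V) (hA : G.IsGeneralizedVertex A) (hB : G.IsGeneralizedVertex B),
    P A hA * P B hB = P (A ∩ B) (.inter hA hB)
  P_union : ∀ (A B : Set V) (hA : G.IsGeneralizedVertex A) (hB : G.IsGeneralizedVertex B),
    P (A ∪ B) (.union hA hB) = P A hA + P B hB - P (A ∩ B) (.inter hA hB)
  P_source_mul_S : ∀ e, P {G.source e} (.singleton _) * S e = S e
  S_mul_P_range : ∀ e, S e * P (G.range e) (.range e) = S e
  P_range_mul_T : ∀ e, P (G.range e) (.range e) * T e = T e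
  T_mul_P_source : ∀ e, T e * P {G.source e} (.singleton _) = T e
  T_mul_S_self : ∀ e, T e * S e = P (G.range e) (.range e)
  T_mul_S_of_ne : ∀ e f, e ≠ f → T e * S f = 0
  vertex_sum : ∀ (x : V) (hfin : {e : E | G.source e = x}.Finite),
    {e : E | G.source e = x}.Nonempty → P {x} (.singleton x) = ∑ e ∈ hfin.toFinset, S e * T e

namespace LeavittFamily

variable {V : Type*} {E : Type*} {G : Ultragraph V E} {U : Type*} [Ring U]
  (L : LeavittFamily G U)

/-- The idempotent `p_v` of a vertex `v`. -/
def pv (v : V) : U := L.P {v} (.singleton v)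

theorem P_congr {A B : Set V} (h : A = B) (hA : G.IsGeneralizedVertex A)
    (hB : G.IsGeneralizedVertex B) : L.P A hA = L.P B hB := by
  subst h; rfl

theorem P_eq_zero {A : Set V} (h : A = ∅) (hA : G.IsGeneralizedVertex A) : L.P A hA = 0 :=
  (L.P_congr h hA .empty).trans L.P_empty

theorem P_comm {A B : Set V} (hA : G.IsGeneralizedVertex A) (hB : G.IsGeneralizedVertex B) :
    L.P A hA * L.P B hB = L.P B hB * L.P A hA := by
  rw [L.P_mul, L.P_mul]; exact L.P_congr (Set.inter_comm _ _) _ _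

theorem P_mul_self {A : Set V} (hA : G.IsGeneralizedVertex A) :
    L.P A hA * L.P A hA = L.P A hA := by
  rw [L.P_mul]; exact L.P_congr (Set.inter_self _) _ _

theorem P_mul_pv_of_mem {A : Set V} (hA : G.IsGeneralizedVertex A) {v : V} (h : v ∈ A) :
    L.P A hA * L.pv v = L.pv v := by
  rw [pv, L.P_mul]; exact L.P_congr (by simpa using h) _ _

theorem P_mul_pv_of_notMem {A : Set V} (hA : G.IsGeneralizedVertex A) {v : V} (h : v ∉ A) :
    L.P A hA * L.pv v = 0 := by
  rw [pv, L.P_mul]; exact L.P_eq_zero (by simpa using h) _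

theorem pv_mul_self (v : V) : L.pv v * L.pv v = L.pv v := L.P_mul_self _

theorem pv_mul_pv_of_ne {v w : V} (h : v ≠ w) : L.pv v * L.pv w = 0 :=
  L.P_mul_pv_of_notMem _ (by simpa using h.symm)

theorem pv_mul_S_of_eq {v : V} {e : E} (h : G.source e = v) : L.pv v * L.S e = L.S e := by
  subst h; exact L.P_source_mul_S e

theorem pv_mul_S_of_ne {v : V} {e : E} (h : G.source e ≠ v) : L.pv v * L.S e = 0 := by
  rw [← L.pv_mul_S_of_eq rfl, ← mul_assoc, L.pv_mul_pv_of_ne h.symm, zero_mul]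

theorem T_mul_pv_of_eq {v : V} {e : E} (h : G.source e = v) : L.T e * L.pv v = L.T e := by
  subst h; exact L.T_mul_P_source e

theorem T_mul_pv_of_ne {v : V} {e : E} (h : G.source e ≠ v) : L.T e * L.pv v = 0 := by
  rw [← L.T_mul_pv_of_eq rfl, mul_assoc, L.pv_mul_pv_of_ne h, mul_zero]

open Classical in
theorem P_mul_S {A : Set V} (hA : G.IsGeneralizedVertex A) (e : E) :
    L.P A hA * L.S e = if G.source e ∈ A then L.S e else 0 := by
  rw [← L.pv_mul_S_of_eq rfl, ← mul_assoc]
  split_ifs with h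
  · rw [L.P_mul_pv_of_mem hA h]
  · rw [L.P_mul_pv_of_notMem hA h, zero_mul]

open Classical in
theorem T_mul_P {A : Set V} (hA : G.IsGeneralizedVertex A) (e : E) :
    L.T e * L.P A hA = if G.source e ∈ A then L.T e else 0 := by
  rw [← L.T_mul_pv_of_eq rfl, mul_assoc, pv, L.P_comm, ← pv]
  split_ifs with h
  · rw [L.P_mul_pv_of_mem hA h]
  · rw [L.P_mul_pv_of_notMem hA h, mul_zero]

theorem S_mul_T_mul_S_self (e : E) : L.S e * L.T e * L.S e = L.S e := by
  rw [mul_assoc, L.T_mul_S_self, L.S_mul_P_range]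

theorem T_mul_S_mul_T_self (e : E) : L.T e * L.S e * L.T e = L.T e := by
  rw [L.T_mul_S_self, L.P_range_mul_T]

variable (R : Type*) [CommRing R] [Algebra R U]

/-! ### Spanning submodules -/

/-- The span of the `s_e`. -/
def spanS : Submodule R U := Submodule.span R (Set.range L.S)

/-- The span of the `s_e^*`. -/
def spanT : Submodule R U := Submodule.span R (Set.range L.T)

/-- The span of the `p_A`. -/
def spanP : Submodule R U :=
  Submodule.span R (Set.range fun A : {A : Set V // G.IsGeneralizedVertex A} => L.P A.1 A.2)

theorem S_mem (e : E) : L.S e ∈ L.spanS R := Submodule.subset_span ⟨e, rfl⟩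

theorem T_mem (e : E) : L.T e ∈ L.spanT R := Submodule.subset_span ⟨e, rfl⟩

theorem P_mem {A : Set V} (hA : G.IsGeneralizedVertex A) : L.P A hA ∈ L.spanP R :=
  Submodule.subset_span ⟨⟨A, hA⟩, rfl⟩

theorem pv_mem (v : V) : L.pv v ∈ L.spanP R := L.P_mem R _

theorem spanP_mul_spanP : L.spanP R * L.spanP R ≤ L.spanP R := by
  rw [spanP, Submodule.span_mul_span, Submodule.span_le]
  rintro _ ⟨_, ⟨A, rfl⟩, _, ⟨B, rfl⟩, rfl⟩
  simp only [L.P_mul]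
  exact L.P_mem R _

theorem spanP_mul_spanS : L.spanP R * L.spanS R ≤ L.spanS R := by
  rw [spanP, spanS, Submodule.span_mul_span, Submodule.span_le]
  rintro _ ⟨_, ⟨A, rfl⟩, _, ⟨e, rfl⟩, rfl⟩
  simp only [L.P_mul_S]
  split_ifs
  · exact L.S_mem R e
  · exact zero_mem _

theorem spanT_mul_spanP : L.spanT R * L.spanP R ≤ L.spanT R := by
  rw [spanP, spanT, Submodule.span_mul_span, Submodule.span_le]
  rintro _ ⟨_, ⟨e, rfl⟩, _, ⟨A, rfl⟩, rfl⟩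
  simp only [L.T_mul_P]
  split_ifs
  · exact L.T_mem R e
  · exact zero_mem _

theorem spanT_mul_spanS : L.spanT R * L.spanS R ≤ L.spanP R := by
  rw [spanT, spanS, Submodule.span_mul_span, Submodule.span_le]
  rintro _ ⟨_, ⟨e, rfl⟩, _, ⟨f, rfl⟩, rfl⟩
  rcases eq_or_ne e f with rfl | h
  · simp only [L.T_mul_S_self]; exact L.P_mem R _
  · simp only [L.T_mul_S_of_ne e f h]; exact zero_mem _

theorem spanS_le : L.spanS R ≤ L.spanS R * L.spanP R := by
  rw [spanS, Submodule.span_le]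
  rintro _ ⟨e, rfl⟩
  rw [SetLike.mem_coe, ← L.S_mul_P_range]
  exact Submodule.mul_mem_mul (L.S_mem R e) (L.P_mem R _)

theorem spanT_le : L.spanT R ≤ L.spanP R * L.spanT R := by
  rw [spanT, Submodule.span_le]
  rintro _ ⟨e, rfl⟩
  rw [SetLike.mem_coe, ← L.P_range_mul_T]
  exact Submodule.mul_mem_mul (L.P_mem R _) (L.T_mem R e)

/-- The span of the `s_α p_A s_β^*` with `α`, `β` paths of lengths `k` and `l`. -/
def block (k l : ℕ) : Submodule R U := L.spanS R ^ k * L.spanP R * L.spanT R ^ l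

theorem block_zero_right (k : ℕ) : L.block R k 0 = L.spanS R ^ k * L.spanP R := by
  rw [block, pow_zero, mul_one]

theorem block_succ_left (k l : ℕ) : L.block R (k + 1) l = L.spanS R * L.block R k l := by
  simp only [block, pow_succ', mul_assoc]

theorem block_succ_right (k l : ℕ) : L.block R k (l + 1) = L.block R k l * L.spanT R := by
  simp only [block, pow_succ, mul_assoc]

theorem spanP_mul_block (k l : ℕ) : L.spanP R * L.block R k l ≤ L.block R k l := by
  cases k with
  | zero =>
    rw [block, pow_zero, one_mul, ← mul_assoc]
    exact mul_le_mul_left (L.spanP_mul_spanP R) _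
  | succ k =>
    rw [block_succ_left, ← mul_assoc]
    exact mul_le_mul_left (L.spanP_mul_spanS R) _

theorem block_mul_spanP (k l : ℕ) : L.block R k l * L.spanP R ≤ L.block R k l := by
  cases l with
  | zero =>
    rw [block, pow_zero, mul_one, mul_assoc]
    exact mul_le_mul_right (L.spanP_mul_spanP R) _
  | succ l =>
    rw [block_succ_right, mul_assoc]
    exact mul_le_mul_right (L.spanT_mul_spanP R) _

theorem spanT_mul_block_succ (k l : ℕ) : L.spanT R * L.block R (k + 1) l ≤ L.block R k l := by
  rw [block_succ_left, ← mul_assoc]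
  exact (mul_le_mul_left (L.spanT_mul_spanS R) _).trans (L.spanP_mul_block R k l)

theorem block_succ_mul_spanS (k l : ℕ) : L.block R k (l + 1) * L.spanS R ≤ L.block R k l := by
  rw [block_succ_right, mul_assoc]
  exact (mul_le_mul_right (L.spanT_mul_spanS R) _).trans (L.block_mul_spanP R k l)

theorem spanT_mul_block_zero (l : ℕ) : L.spanT R * L.block R 0 l ≤ L.block R 0 (l + 1) := by
  rw [block, block, pow_zero, one_mul, ← mul_assoc, pow_succ', ← mul_assoc]
  exact mul_le_mul_left ((L.spanT_mul_spanP R).trans (L.spanT_le R)) _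

theorem block_zero_mul_spanS (k : ℕ) : L.block R k 0 * L.spanS R ≤ L.block R (k + 1) 0 := by
  rw [block_zero_right, block_zero_right, mul_assoc, pow_succ, mul_assoc]
  exact mul_le_mul_right ((L.spanP_mul_spanS R).trans (L.spanS_le R)) _

/-- A combination of elements `s_e y` is fixed by left multiplication with `∑_{e ∈ F} s_e s_e^*`
for a finite set `F`; in particular it vanishes if all `s_e^*` kill it. -/
theorem exists_sum_S_mul_T_mul (Y : Submodule R U) {x : U} (hx : x ∈ L.spanS R * Y) :
    ∃ F : Finset E, x = ∑ e ∈ F, L.S e * L.T e * x := by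
  classical
  suffices h : ∃ F₀ : Finset E, ∀ F, F₀ ⊆ F → x = ∑ e ∈ F, L.S e * L.T e * x by
    obtain ⟨F₀, h⟩ := h; exact ⟨F₀, h F₀ subset_rfl⟩
  induction hx using Submodule.mul_induction_on' with
  | mem_mul_mem s hs y hy =>
    induction hs using Submodule.span_induction with
    | mem s hs =>
      obtain ⟨f, rfl⟩ := hs
      refine ⟨{f}, fun F hF => ?_⟩
      rw [Finset.sum_eq_single_of_mem f (hF (by simp)), ← mul_assoc, L.S_mul_T_mul_S_self]
      intro e _ he
      rw [mul_assoc, ← mul_assoc (L.T e), L.T_mul_S_of_ne e f he, zero_mul, mul_zero]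
    | zero => exact ⟨∅, fun F _ => by simp⟩
    | add s t _ _ hs ht =>
      obtain ⟨F₁, h₁⟩ := hs
      obtain ⟨F₂, h₂⟩ := ht
      refine ⟨F₁ ∪ F₂, fun F hF => ?_⟩
      rw [add_mul]
      simp only [mul_add, Finset.sum_add_distrib]
      rw [← h₁ F (Finset.union_subset_left hF), ← h₂ F (Finset.union_subset_right hF)]
    | smul r s _ hs =>
      obtain ⟨F₁, h₁⟩ := hs
      refine ⟨F₁, fun F hF => ?_⟩
      simp only [smul_mul_assoc, mul_smul_comm, ← Finset.smul_sum]
      rw [← h₁ F hF]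
  | add s _ t _ hs ht =>
    obtain ⟨F₁, h₁⟩ := hs
    obtain ⟨F₂, h₂⟩ := ht
    refine ⟨F₁ ∪ F₂, fun F hF => ?_⟩
    simp only [mul_add, Finset.sum_add_distrib]
    rw [← h₁ F (Finset.union_subset_left hF), ← h₂ F (Finset.union_subset_right hF)]

/-- The mirror image of `exists_sum_S_mul_T_mul`. -/
theorem exists_sum_mul_S_mul_T (Y : Submodule R U) {x : U} (hx : x ∈ Y * L.spanT R) :
    ∃ F : Finset E, x = ∑ e ∈ F, x * L.S e * L.T e := by
  classical
  suffices h : ∃ F₀ : Finset E, ∀ F, F₀ ⊆ F → x = ∑ e ∈ F, x * L.S e * L.T e by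
    obtain ⟨F₀, h⟩ := h; exact ⟨F₀, h F₀ subset_rfl⟩
  induction hx using Submodule.mul_induction_on' with
  | mem_mul_mem y hy s hs =>
    induction hs using Submodule.span_induction with
    | mem s hs =>
      obtain ⟨f, rfl⟩ := hs
      refine ⟨{f}, fun F hF => ?_⟩
      rw [Finset.sum_eq_single_of_mem f (hF (by simp)), mul_assoc, mul_assoc, ← mul_assoc (L.T f),
        L.T_mul_S_mul_T_self]
      intro e _ he
      rw [mul_assoc y, L.T_mul_S_of_ne f e he.symm, mul_zero, zero_mul]
    | zero => exact ⟨∅, fun F _ => by simp⟩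
    | add s t _ _ hs ht =>
      obtain ⟨F₁, h₁⟩ := hs
      obtain ⟨F₂, h₂⟩ := ht
      refine ⟨F₁ ∪ F₂, fun F hF => ?_⟩
      rw [mul_add]
      simp only [add_mul, Finset.sum_add_distrib]
      rw [← h₁ F (Finset.union_subset_left hF), ← h₂ F (Finset.union_subset_right hF)]
    | smul r s _ hs =>
      obtain ⟨F₁, h₁⟩ := hs
      refine ⟨F₁, fun F hF => ?_⟩
      simp only [smul_mul_assoc, mul_smul_comm, ← Finset.smul_sum]
      rw [← h₁ F hF]
  | add s _ t _ hs ht =>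
    obtain ⟨F₁, h₁⟩ := hs
    obtain ⟨F₂, h₂⟩ := ht
    refine ⟨F₁ ∪ F₂, fun F hF => ?_⟩
    simp only [add_mul, Finset.sum_add_distrib]
    rw [← h₁ F (Finset.union_subset_left hF), ← h₂ F (Finset.union_subset_right hF)]

/-! ### Detecting elements on vertices -/

variable {R}

/-- The relative complement `p_C - p_{C ∩ D}` is an idempotent that is either zero or dominates
some `p_v`. Splitting it along one more set `A` at a time reduces a combination of projections to
a scalar multiple of such idempotents; the scalar term `r • 1` makes the induction close. -/
theorem diff_mul_eq_zero (htf : ∀ (v : V) (r : R), r • L.pv v = 0 → r = 0)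
    (c : {A : Set V // G.IsGeneralizedVertex A} → R)
    (s : Finset {A : Set V // G.IsGeneralizedVertex A}) :
    ∀ (r : R) (C D : Set V) (hC : G.IsGeneralizedVertex C) (hD : G.IsGeneralizedVertex D),
      (∀ v, (L.P C hC - L.P (C ∩ D) (.inter hC hD)) *
        (r • (1 : U) + ∑ A ∈ s, c A • L.P A.1 A.2) * L.pv v = 0) →
      (L.P C hC - L.P (C ∩ D) (.inter hC hD)) *
        (r • (1 : U) + ∑ A ∈ s, c A • L.P A.1 A.2) = 0 := by
  classical
  induction s using Finset.induction_on with
  | empty =>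
    intro r C D hC hD h
    by_cases hCD : C ⊆ D
    · rw [L.P_congr (Set.inter_eq_left.2 hCD) (.inter hC hD) hC, sub_self, zero_mul]
    · obtain ⟨v, hvC, hvD⟩ := Set.not_subset.1 hCD
      have h₁ := h v
      simp only [Finset.sum_empty, add_zero, mul_smul_comm, mul_one, smul_mul_assoc, sub_mul,
        L.P_mul_pv_of_mem hC hvC,
        L.P_mul_pv_of_notMem (.inter hC hD) (fun h => hvD h.2), sub_zero] at h₁
      rw [htf v r h₁]
      simp
  | insert A s hA ih =>
    intro r C D hC hD h
    rw [Finset.sum_insert hA] at h ⊢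
    set y := ∑ B ∈ s, c B • L.P B.1 B.2 with hy
    set q := L.P C hC - L.P (C ∩ D) (.inter hC hD) with hq
    set p := L.P A.1 A.2 with hp
    have hpp : p * p = p := L.P_mul_self _
    have hpy : y * p = p * y := by
      simp only [hy, Finset.sum_mul, Finset.mul_sum, smul_mul_assoc, mul_smul_comm]
      exact Finset.sum_congr rfl fun B _ => by rw [hp, L.P_comm]
    have hpv (v : V) : p * L.pv v = L.pv v * p := L.P_comm _ _
    have hq₁ : L.P (C ∩ A.1) (.inter hC A.2) -
        L.P ((C ∩ A.1) ∩ D) (.inter (.inter hC A.2) hD) = q * p := by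
      rw [hq, hp, sub_mul, L.P_mul, L.P_mul]
      congr 1
      exact L.P_congr (Set.inter_right_comm _ _ _) _ _
    have hq₂ : L.P C hC - L.P (C ∩ (A.1 ∪ D)) (.inter hC (.union A.2 hD)) = q - q * p := by
      have h₁ : L.P C hC * L.P (A.1 ∩ D) (.inter A.2 hD) =
          L.P ((C ∩ A.1) ∩ D) (.inter (.inter hC A.2) hD) := by
        rw [← L.P_mul _ _ (.inter hC A.2) hD, ← L.P_mul _ _ hC A.2, ← L.P_mul _ _ A.2 hD, mul_assoc]
      rw [← hq₁, hq, ← L.P_mul C (A.1 ∪ D) hC (.union A.2 hD), L.P_union A.1 D A.2 hD,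
        mul_sub, mul_add, h₁, L.P_mul, L.P_mul]
      abel
    have e₁ : q * p * ((r + c A) • (1 : U) + y) = q * (r • (1 : U) + (c A • p + y)) * p := by
      have : (r • (1 : U) + (c A • p + y)) * p = p * ((r + c A) • (1 : U) + y) := by
        simp only [add_mul, mul_add, smul_mul_assoc, mul_smul_comm, hpp, hpy, one_mul, mul_one,
          add_smul]
        abel
      rw [mul_assoc, mul_assoc, this]
    have e₂ : (q - q * p) * (r • (1 : U) + y) =
        q * (r • (1 : U) + (c A • p + y)) * (1 - p) := by
      have : (r • (1 : U) + (c A • p + y)) * (1 - p) = (1 - p) * (r • (1 : U) + y) := by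
        simp only [add_mul, mul_add, sub_mul, mul_sub, smul_mul_assoc, mul_smul_comm, hpp, hpy,
          one_mul, mul_one, smul_sub]
        abel
      rw [mul_assoc, this, ← mul_assoc, mul_sub, mul_one]
    have h₁ := ih (r + c A) (C ∩ A.1) D (.inter hC A.2) hD fun v => by
      rw [hq₁, e₁, mul_assoc, hpv, ← mul_assoc, h, zero_mul]
    have h₂ := ih r C (A.1 ∪ D) hC (.union A.2 hD) fun v => by
      have hpv' : (1 - p) * L.pv v = L.pv v * (1 - p) := by
        rw [sub_mul, mul_sub, one_mul, mul_one, hpv]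
      rw [hq₂, e₂, mul_assoc, hpv', ← mul_assoc, h, zero_mul]
    rw [hq₁, e₁] at h₁
    rw [hq₂, e₂, mul_sub, mul_one, h₁, sub_zero] at h₂
    exact h₂

theorem exists_P_mul_eq {x : U} (hx : x ∈ L.spanP R) :
    ∃ (C : Set V) (hC : G.IsGeneralizedVertex C), L.P C hC * x = x := by
  suffices h : ∃ (C : Set V) (_ : G.IsGeneralizedVertex C),
      ∀ (D : Set V) (hD : G.IsGeneralizedVertex D), C ⊆ D → L.P D hD * x = x by
    obtain ⟨C, hC, h⟩ := h
    exact ⟨C, hC, h C hC subset_rfl⟩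
  induction hx using Submodule.span_induction with
  | mem x hx =>
    obtain ⟨A, rfl⟩ := hx
    refine ⟨A.1, A.2, fun D hD h => ?_⟩
    simp only [L.P_mul]
    exact L.P_congr (Set.inter_eq_right.2 h) _ _
  | zero => exact ⟨∅, .empty, fun _ _ _ => mul_zero _⟩
  | add x y _ _ hx hy =>
    obtain ⟨C, hC, hx⟩ := hx
    obtain ⟨D, hD, hy⟩ := hy
    refine ⟨C ∪ D, .union hC hD, fun B hB h => ?_⟩
    rw [mul_add, hx B hB (Set.subset_union_left.trans h), hy B hB (Set.subset_union_right.trans h)]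
  | smul r x _ hx =>
    obtain ⟨C, hC, hx⟩ := hx
    exact ⟨C, hC, fun B hB h => by rw [mul_smul_comm, hx B hB h]⟩

/-- An element of the span of the projections is determined by its values at the vertices. -/
theorem eq_zero_of_forall_mul_pv (htf : ∀ (v : V) (r : R), r • L.pv v = 0 → r = 0) {x : U}
    (hx : x ∈ L.spanP R) (h : ∀ v, x * L.pv v = 0) : x = 0 := by
  obtain ⟨C, hC, hCx⟩ := L.exists_P_mul_eq hx
  obtain ⟨c, rfl⟩ := (Finsupp.mem_span_range_iff_exists_finsupp).1 hx
  have key := L.diff_mul_eq_zero htf c c.support 0 C ∅ hC .empty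
  rw [L.P_eq_zero (Set.inter_empty C) (.inter hC .empty), sub_zero, zero_smul, zero_add] at key
  simp only [Finsupp.sum] at hCx h ⊢
  rw [hCx] at key
  exact key h

theorem exists_mul_pv_eq_smul {x : U} (hx : x ∈ L.spanP R) (v : V) :
    ∃ r : R, x * L.pv v = r • L.pv v := by
  induction hx using Submodule.span_induction with
  | mem x hx =>
    obtain ⟨A, rfl⟩ := hx
    by_cases h : v ∈ A.1
    · exact ⟨1, by rw [L.P_mul_pv_of_mem A.2 h, one_smul]⟩
    · exact ⟨0, by rw [L.P_mul_pv_of_notMem A.2 h, zero_smul]⟩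
  | zero => exact ⟨0, by simp⟩
  | add x y _ _ hx hy =>
    obtain ⟨r, hr⟩ := hx
    obtain ⟨s, hs⟩ := hy
    exact ⟨r + s, by rw [add_mul, hr, hs, add_smul]⟩
  | smul t x _ hx =>
    obtain ⟨r, hr⟩ := hx
    exact ⟨t * r, by rw [smul_mul_assoc, hr, mul_smul]⟩

/-- A nonzero combination of elements `s_α p_A` with `α` of length `n` is compressed to a nonzero
multiple of some `p_v` by removing the paths `α` one edge at a time. -/
theorem exists_compress_of_mem_block_zero (htf : ∀ (v : V) (r : R), r • L.pv v = 0 → r = 0)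
    (n : ℕ) : ∀ x ∈ L.block R n 0, x ≠ 0 →
      ∃ t ∈ L.spanT R ^ n, ∃ (v : V) (r : R), r ≠ 0 ∧ t * x * L.pv v = r • L.pv v := by
  induction n with
  | zero =>
    intro x hx hx0
    rw [block_zero_right, pow_zero, one_mul] at hx
    obtain ⟨v, hv⟩ : ∃ v, x * L.pv v ≠ 0 := by
      by_contra! h
      exact hx0 (L.eq_zero_of_forall_mul_pv htf hx h)
    obtain ⟨r, hr⟩ := L.exists_mul_pv_eq_smul hx v
    refine ⟨1, by rw [pow_zero]; exact Submodule.one_le.1 le_rfl, v, r, ?_, by rw [one_mul, hr]⟩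
    rintro rfl
    exact hv (by rw [hr, zero_smul])
  | succ n ih =>
    intro x hx hx0
    obtain ⟨F, hF⟩ := L.exists_sum_S_mul_T_mul R _ (by rwa [block_succ_left] at hx)
    obtain ⟨e, he⟩ : ∃ e, L.T e * x ≠ 0 := by
      by_contra! h
      apply hx0
      rw [hF]
      exact Finset.sum_eq_zero fun e _ => by rw [mul_assoc, h, mul_zero]
    obtain ⟨t, ht, v, r, hr, h⟩ := ih (L.T e * x)
      (L.spanT_mul_block_succ R n 0 (Submodule.mul_mem_mul (L.T_mem R e) hx)) he
    refine ⟨t * L.T e, ?_, v, r, hr, by rw [mul_assoc t, h]⟩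
    rw [pow_succ]
    exact Submodule.mul_mem_mul ht (L.T_mem R e)

end LeavittFamily
end Ultragraph

namespace Ultragraph
namespace LeavittFamily

variable {V : Type*} {E : Type*} {G : Ultragraph V E} {U : Type*} [Ring U]
  (L : LeavittFamily G U) {R : Type*} [CommRing R] [Algebra R U]

/-! ### Compressing a homogeneous element to a vertex -/

/-- If `a = x (1 - ∑_{e ∈ F} s_e s_e^*)`, with `x` free of ghost edges, is killed by all `s_e`,
then either `a = 0` or `a` is compressed to a nonzero multiple of some `p_v`. The vertices all of
whose emitted edges lie in `F` contribute nothing to `a` by the relation at regular vertices, and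
each other vertex `v` seen by `x` either emits no edge of `F`, so that `a p_v = x p_v`, or emits
an edge `f` outside `F`, where `a s_f = x s_f` does not vanish. -/
theorem exists_compress_of_forall_mul_S_eq_zero
    (htf : ∀ (v : V) (r : R), r • L.pv v = 0 → r = 0) {n : ℕ} {x a : U}
    (hx : x ∈ L.block R n 0) (F : Finset E) (ha : a = x - ∑ e ∈ F, x * L.S e * L.T e)
    (haS : ∀ e, a * L.S e = 0) (ha0 : a ≠ 0) :
    ∃ t ∈ L.spanT R ^ n, ∃ (v : V) (r : R), r ≠ 0 ∧ t * a * L.pv v = r • L.pv v := by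
  classical
  let W : Finset V := (F.image G.source).filter fun v => ∀ e, G.source e = v → e ∈ F
  obtain ⟨p, hp⟩ : ∃ p, p = ∑ v ∈ W, L.pv v := ⟨_, rfl⟩
  have hpP : p ∈ L.spanP R := by
    rw [hp]; exact Submodule.sum_mem _ fun v _ => L.pv_mem R v
  have hz : x - x * p ∈ L.block R n 0 :=
    Submodule.sub_mem _ hx (L.block_mul_spanP R n 0 (Submodule.mul_mem_mul hx hpP))
  by_cases hz0 : x - x * p = 0
  · refine absurd ?_ ha0
    have hxp : x = x * p := sub_eq_zero.1 hz0
    have hW : ∀ v ∈ W, L.pv v - ∑ e ∈ F, L.pv v * (L.S e * L.T e) = 0 := by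
      intro v hv
      obtain ⟨hvF, hvW⟩ := Finset.mem_filter.1 hv
      obtain ⟨e₀, -, he₀⟩ := Finset.mem_image.1 hvF
      have hfin : {e : E | G.source e = v}.Finite :=
        F.finite_toSet.subset fun e he => hvW e he
      have hsub : hfin.toFinset ⊆ F := fun e he => hvW e (by simpa using he)
      refine sub_eq_zero.2 ((L.vertex_sum v hfin ⟨e₀, he₀⟩).trans ?_)
      rw [← Finset.sum_subset hsub]
      · refine Finset.sum_congr rfl fun e he => ?_
        rw [← mul_assoc, L.pv_mul_S_of_eq (by simpa using he)]
      · intro e _ he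
        rw [← mul_assoc, L.pv_mul_S_of_ne (by simpa using he), zero_mul]
    have : p - ∑ e ∈ F, p * (L.S e * L.T e) = 0 := by
      simp only [hp, Finset.sum_mul]
      rw [Finset.sum_comm, ← Finset.sum_sub_distrib]
      exact Finset.sum_eq_zero hW
    have h₂ : a = x * p - ∑ e ∈ F, x * p * L.S e * L.T e := by rw [← hxp, ha]
    rw [h₂, ← mul_zero x, ← this, mul_sub, Finset.mul_sum]
    simp only [mul_assoc]
  · obtain ⟨t, ht, v, r, hr, h⟩ := L.exists_compress_of_mem_block_zero htf n _ hz hz0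
    have hvW : v ∉ W := by
      intro hv
      have : p * L.pv v = L.pv v := by
        rw [hp, Finset.sum_mul, Finset.sum_eq_single_of_mem v hv, L.pv_mul_self]
        exact fun w _ hw => L.pv_mul_pv_of_ne hw
      rw [mul_assoc, sub_mul, mul_assoc x, this, sub_self, mul_zero] at h
      exact hr (htf v r h.symm)
    have hpv : p * L.pv v = 0 := by
      rw [hp, Finset.sum_mul]
      exact Finset.sum_eq_zero fun w hw => L.pv_mul_pv_of_ne (by rintro rfl; exact hvW hw)
    rw [mul_assoc, sub_mul, mul_assoc x, hpv, mul_zero, sub_zero] at h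
    refine ⟨t, ht, v, r, hr, ?_⟩
    by_cases hvF : v ∈ F.image G.source
    · obtain ⟨f, hfv, hfF⟩ : ∃ f, G.source f = v ∧ f ∉ F := by
        by_contra! hcon
        exact hvW (Finset.mem_filter.2 ⟨hvF, hcon⟩)
      have h₁ : x * L.S f = 0 := by
        rw [← haS f, ha, sub_mul, Finset.sum_mul, Finset.sum_eq_zero, sub_zero]
        intro e he
        rw [mul_assoc, L.T_mul_S_of_ne e f (by rintro rfl; exact hfF he), mul_zero]
      have h₂ : r • L.S f = 0 := by
        rw [← L.pv_mul_S_of_eq hfv, ← smul_mul_assoc, ← h, mul_assoc, mul_assoc,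
          L.pv_mul_S_of_eq hfv, h₁, mul_zero]
      obtain ⟨w, hw⟩ := G.range_nonempty f
      refine absurd (htf w r ?_) hr
      rw [← L.P_mul_pv_of_mem (.range f) hw, ← L.T_mul_S_self, ← smul_mul_assoc,
        ← mul_smul_comm, h₂, mul_zero, zero_mul]
    · rw [← h, mul_assoc, ha, sub_mul, Finset.sum_mul, Finset.sum_eq_zero, sub_zero]
      intro e he
      rw [mul_assoc, L.T_mul_pv_of_ne, mul_zero]
      rintro rfl
      exact hvF (Finset.mem_image_of_mem _ he)

variable (R)

/-- The elements of degree `d` whose ghost paths have length at most `m`. -/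
def homogeneousLE (d : ℤ) (m : ℕ) : Submodule R U :=
  ⨆ (k : ℕ) (l : ℕ) (_ : (k : ℤ) = d + l) (_ : l ≤ m), L.block R k l

theorem block_le_homogeneousLE {d : ℤ} {m k l : ℕ} (h : (k : ℤ) = d + l) (hl : l ≤ m) :
    L.block R k l ≤ L.homogeneousLE R d m :=
  le_iSup₂_of_le k l (le_iSup₂_of_le h hl le_rfl)

theorem homogeneousLE_le {d : ℤ} {m : ℕ} {Y : Submodule R U}
    (h : ∀ k l : ℕ, (k : ℤ) = d + l → l ≤ m → L.block R k l ≤ Y) : L.homogeneousLE R d m ≤ Y :=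
  iSup₂_le fun k l => iSup₂_le fun hk hl => h k l hk hl

theorem homogeneousLE_mono (d : ℤ) : Monotone (L.homogeneousLE R d) := fun _ _ hmn =>
  L.homogeneousLE_le R fun _ _ hk hl => L.block_le_homogeneousLE R hk (hl.trans hmn)

theorem homogeneousLE_succ_mul_S (d : ℤ) (m : ℕ) {a : U} (ha : a ∈ L.homogeneousLE R d (m + 1))
    (e : E) : a * L.S e ∈ L.homogeneousLE R (d + 1) m := by
  suffices h : L.homogeneousLE R d (m + 1) ≤
      (L.homogeneousLE R (d + 1) m).comap (LinearMap.mulRight R (L.S e)) from h ha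
  refine L.homogeneousLE_le R fun k l hk hl x hx => ?_
  rw [Submodule.mem_comap, LinearMap.mulRight_apply]
  have hxS := Submodule.mul_mem_mul hx (L.S_mem R e)
  cases l with
  | zero =>
    exact L.block_le_homogeneousLE R (by push_cast at hk ⊢; omega) (Nat.zero_le m)
      (L.block_zero_mul_spanS R k hxS)
  | succ l =>
    exact L.block_le_homogeneousLE R (by push_cast at hk ⊢; omega) (by omega)
      (L.block_succ_mul_spanS R k l hxS)

variable {R}

/-- Elements of degree `d` without ghost edges form a single block, or vanish if `d < 0`. -/
theorem exists_mem_block_zero {d : ℤ} {x : U} (hx : x ∈ L.homogeneousLE R d 0) (hx0 : x ≠ 0) :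
    ∃ n : ℕ, (n : ℤ) = d ∧ x ∈ L.block R n 0 := by
  by_cases hd : 0 ≤ d
  · lift d to ℕ using hd
    refine ⟨d, rfl, ?_⟩
    suffices h : L.homogeneousLE R d 0 ≤ L.block R d 0 from h hx
    refine L.homogeneousLE_le R fun k l hk hl => ?_
    obtain rfl : l = 0 := by omega
    obtain rfl : k = d := by omega
    exact le_rfl
  · refine absurd ?_ hx0
    suffices h : L.homogeneousLE R d 0 ≤ ⊥ from h hx
    exact L.homogeneousLE_le R fun k l hk hl => by omega

/-- Every nonzero homogeneous element is compressed to a nonzero multiple of some `p_v`. -/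
theorem exists_compress_of_mem_homogeneousLE
    (htf : ∀ (v : V) (r : R), r • L.pv v = 0 → r = 0) (m : ℕ) :
    ∀ (d : ℤ), ∀ a ∈ L.homogeneousLE R d m, a ≠ 0 →
      ∃ k l : ℕ, (k : ℤ) = d + l ∧ ∃ t ∈ L.spanT R ^ k, ∃ s ∈ L.spanS R ^ l * L.spanP R,
        ∃ (v : V) (r : R), r ≠ 0 ∧ t * a * s = r • L.pv v := by
  have hpv (v : V) : L.pv v ∈ L.spanS R ^ 0 * L.spanP R := by
    rw [pow_zero, one_mul]; exact L.pv_mem R v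
  induction m with
  | zero =>
    intro d a ha ha0
    obtain ⟨n, rfl, hn⟩ := L.exists_mem_block_zero ha ha0
    obtain ⟨t, ht, v, r, hr, h⟩ := L.exists_compress_of_mem_block_zero htf n a hn ha0
    exact ⟨n, 0, by simp, t, ht, L.pv v, hpv v, v, r, hr, h⟩
  | succ m ih =>
    intro d a ha ha0
    by_cases haS : ∀ e, a * L.S e = 0
    · have hle : L.homogeneousLE R d (m + 1) ≤ L.homogeneousLE R d 0 ⊔ ⊤ * L.spanT R := by
        refine L.homogeneousLE_le R fun k l hk _ => ?_
        cases l with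
        | zero => exact (L.block_le_homogeneousLE R hk le_rfl).trans le_sup_left
        | succ l =>
          rw [block_succ_right]
          exact (mul_le_mul_left le_top _).trans le_sup_right
      obtain ⟨x, hx, y, hy, rfl⟩ := Submodule.mem_sup.1 (hle ha)
      obtain ⟨F, hF⟩ := L.exists_sum_mul_S_mul_T R _ hy
      have hxy (e : E) : y * L.S e = -(x * L.S e) :=
        eq_neg_of_add_eq_zero_right (by rw [← add_mul]; exact haS e)
      have hxy' : x + y = x - ∑ e ∈ F, x * L.S e * L.T e := by
        conv_lhs => rw [hF]
        simp only [hxy, neg_mul, Finset.sum_neg_distrib, sub_eq_add_neg]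
      have hx0 : x ≠ 0 := by
        rintro rfl
        exact ha0 (by rw [hxy']; simp)
      obtain ⟨n, rfl, hn⟩ := L.exists_mem_block_zero hx hx0
      obtain ⟨t, ht, v, r, hr, h⟩ :=
        L.exists_compress_of_forall_mul_S_eq_zero htf hn F hxy' haS ha0
      exact ⟨n, 0, by simp, t, ht, L.pv v, hpv v, v, r, hr, h⟩
    · push Not at haS
      obtain ⟨e, he⟩ := haS
      obtain ⟨k, l, hkl, t, ht, s, hs, v, r, hr, h⟩ :=
        ih (d + 1) _ (L.homogeneousLE_succ_mul_S R d m ha e) he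
      refine ⟨k, l + 1, by push_cast; omega, t, ht, L.S e * s, ?_, v, r, hr, ?_⟩
      · rw [pow_succ', mul_assoc]
        exact Submodule.mul_mem_mul (L.S_mem R e) hs
      · rw [← h]
        simp only [mul_assoc]

/-! ### The leading term argument -/

variable (R)

/-- The elements of degree `d`. -/
def homogeneous (d : ℤ) : Submodule R U := ⨆ m : ℕ, L.homogeneousLE R d m

theorem iSup_block_le_iSup_homogeneous :
    ⨆ (k : ℕ) (l : ℕ), L.block R k l ≤ ⨆ d : ℤ, L.homogeneous R d :=
  iSup₂_le fun k l => (L.block_le_homogeneousLE R (d := k - l) (by ring) le_rfl).trans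
    ((le_iSup (L.homogeneousLE R _) l).trans (le_iSup (L.homogeneous R) _))

variable {R}

theorem exists_compress_of_mem_homogeneous
    (htf : ∀ (v : V) (r : R), r • L.pv v = 0 → r = 0) {d : ℤ} {a : U}
    (ha : a ∈ L.homogeneous R d) (ha0 : a ≠ 0) :
    ∃ k l : ℕ, (k : ℤ) = d + l ∧ ∃ t ∈ L.spanT R ^ k, ∃ s ∈ L.spanS R ^ l * L.spanP R,
      ∃ (v : V) (r : R), r ≠ 0 ∧ t * a * s = r • L.pv v := by
  obtain ⟨m, ha⟩ :=
    (Submodule.mem_iSup_of_directed _ (L.homogeneousLE_mono R d).directed_le).1 ha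
  exact L.exists_compress_of_mem_homogeneousLE htf m d a ha ha0

/-- An increasing filtration of the algebra for which `s_e`, `s_e^*` and `p_A` have degrees `1`,
`-1` and `0`, and in which the multiples of the vertex idempotents `p_v` by nonzero scalars do not
have negative degree. -/
structure DegreeFiltration (R : Type*) [CommRing R] [Algebra R U] where
  F : ℤ → Submodule R U
  mono : Monotone F
  one_mem : 1 ∈ F 0
  mul_le : ∀ i j, F i * F j ≤ F (i + j)
  S_mem : ∀ e, L.S e ∈ F 1
  T_mem : ∀ e, L.T e ∈ F (-1)
  P_mem : ∀ A hA, L.P A hA ∈ F 0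
  eq_zero_of_smul_pv_mem : ∀ (v : V) (r : R), r • L.pv v ∈ F (-1) → r = 0

namespace DegreeFiltration

variable {L} (D : L.DegreeFiltration R)

theorem mul_mem {i j k : ℤ} {x y : U} (hx : x ∈ D.F i) (hy : y ∈ D.F j) (h : i + j ≤ k) :
    x * y ∈ D.F k :=
  D.mono h (D.mul_le i j (Submodule.mul_mem_mul hx hy))

theorem pow_le {Y : Submodule R U} {i : ℤ} (h : Y ≤ D.F i) (n : ℕ) : Y ^ n ≤ D.F (n * i) := by
  induction n with
  | zero => simpa [Submodule.one_le] using D.one_mem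
  | succ n ih =>
    rw [pow_succ]
    refine (mul_le_mul' ih h).trans ((D.mul_le _ _).trans (D.mono ?_))
    push_cast
    linarith

theorem spanS_le : L.spanS R ≤ D.F 1 := by
  rw [spanS, Submodule.span_le]; rintro _ ⟨e, rfl⟩; exact D.S_mem e

theorem spanT_le : L.spanT R ≤ D.F (-1) := by
  rw [spanT, Submodule.span_le]; rintro _ ⟨e, rfl⟩; exact D.T_mem e

theorem spanP_le : L.spanP R ≤ D.F 0 := by
  rw [spanP, Submodule.span_le]; rintro _ ⟨A, rfl⟩; exact D.P_mem _ _

theorem spanT_pow_le (k : ℕ) : L.spanT R ^ k ≤ D.F (-k) := by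
  simpa using D.pow_le D.spanT_le k

theorem spanS_pow_mul_spanP_le (l : ℕ) : L.spanS R ^ l * L.spanP R ≤ D.F l := by
  refine (mul_le_mul' (D.pow_le D.spanS_le l) D.spanP_le).trans ((D.mul_le _ _).trans ?_)
  simp

theorem homogeneous_le (d : ℤ) : L.homogeneous R d ≤ D.F d := by
  refine iSup_le fun m => L.homogeneousLE_le R fun k l hk _ => ?_
  refine (mul_le_mul' (D.spanS_pow_mul_spanP_le k) (D.spanT_pow_le l)).trans
    ((D.mul_le _ _).trans (D.mono ?_))
  omega

/-- Multiplying `a` so as to turn its component of top degree into `r p_v` gives `r p_v + b` with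
`b` of negative degree, whose square has the leading term `r ^ 2 p_v`. -/
theorem eq_zero_of_forall_mul_mul_eq_zero [NoZeroDivisors R] (D : L.DegreeFiltration R) {a : U}
    (ha : a ∈ ⨆ (k : ℕ) (l : ℕ), L.block R k l) (h : ∀ u, a * u * a = 0) : a = 0 := by
  obtain ⟨f, hf, rfl⟩ := (Submodule.mem_iSup_iff_exists_finsupp _ _).1
    (L.iSup_block_le_iSup_homogeneous R ha)
  by_contra ha0
  have hne : f.support.Nonempty := by
    rw [Finset.nonempty_iff_ne_empty, Ne, Finsupp.support_eq_empty]
    rintro rfl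
    exact ha0 Finsupp.sum_zero_index
  set N := f.support.max' hne with hN
  have hNmem : N ∈ f.support := f.support.max'_mem hne
  have htf (v : V) (r : R) (hr : r • L.pv v = 0) : r = 0 :=
    D.eq_zero_of_smul_pv_mem v r (by rw [hr]; exact zero_mem _)
  obtain ⟨k, l, hkl, t, ht, s, hs, v, r, hr, hts⟩ :=
    L.exists_compress_of_mem_homogeneous htf (hf N) (Finsupp.mem_support_iff.1 hNmem)
  set a := f.sum fun _ x => x with hadef
  set b := a - f N with hb
  have hbF : b ∈ D.F (N - 1) := by
    rw [hb, hadef, Finsupp.sum, ← Finset.add_sum_erase _ _ hNmem, add_sub_cancel_left]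
    refine Submodule.sum_mem _ fun d hd => D.mono ?_ (D.homogeneous_le d (hf d))
    obtain ⟨hdN, hd⟩ := Finset.mem_erase.1 hd
    have := f.support.le_max' d hd
    omega
  have hb' : t * b * s ∈ D.F (-1) :=
    D.mul_mem (D.mul_mem (D.spanT_pow_le k ht) hbF le_rfl) (D.spanS_pow_mul_spanP_le l hs)
      (by omega)
  have hc : t * a * s = r • L.pv v + t * b * s := by
    rw [← hts, hb]; noncomm_ring
  have hcc : (t * a * s) * (t * a * s) = 0 := by
    have : (t * a * s) * (t * a * s) = t * (a * (s * t) * a) * s := by simp only [mul_assoc]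
    rw [this, h, mul_zero, zero_mul]
  have hpF : r • L.pv v ∈ D.F 0 := Submodule.smul_mem _ _ (D.P_mem _ _)
  have hsq : (r * r) • L.pv v = -(r • L.pv v * (t * b * s) + t * b * s * (r • L.pv v) +
      t * b * s * (t * b * s)) := by
    have h₁ : (r * r) • L.pv v = r • L.pv v * r • L.pv v := by
      rw [smul_mul_smul_comm, L.pv_mul_self]
    rw [hc] at hcc
    rw [h₁, eq_neg_iff_add_eq_zero, ← hcc]
    simp only [mul_add, add_mul]
    abel
  refine hr (mul_self_eq_zero.1 (D.eq_zero_of_smul_pv_mem v (r * r) ?_))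
  rw [hsq]
  refine Submodule.neg_mem _ (Submodule.add_mem _ (Submodule.add_mem _ ?_ ?_) ?_)
  · exact D.mul_mem hpF hb' (by norm_num)
  · exact D.mul_mem hb' hpF (by norm_num)
  · exact D.mul_mem hb' hb' (by norm_num)

end DegreeFiltration
end LeavittFamily
end Ultragraph

namespace Ultragraph

/-! ### A representation on functions -/

/-- A branching system for the ultragraph `G`: a set `X` lying over the vertices, with an
injection `ins e` of the points over the range of `e` into the points over the source of `e`, such
that the images for the edges emitted by a vertex `v` partition the points over `v`, if there are
such edges. -/
structure BranchingSystem {V : Type*} {E : Type*} (G : Ultragraph V E) (X : Type*) where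
  vertex : X → V
  vertex_surjective : Function.Surjective vertex
  ins : E → X → X
  ins_inj : ∀ {e f p q}, vertex p ∈ G.range e → vertex q ∈ G.range f → ins e p = ins f q →
    e = f ∧ p = q
  vertex_ins : ∀ {e p}, vertex p ∈ G.range e → vertex (ins e p) = G.source e
  exists_ins : ∀ {e q}, vertex q = G.source e → ∃ f p, vertex p ∈ G.range f ∧ ins f p = q

theorem nonempty_prod_equiv_of_embedding {B : Type u} {K : Type v} [Nonempty B] [Infinite K]
    (f : B ↪ K) :
    Nonempty (B × K ≃ K) := by
  have h : Cardinal.lift.{v} (Cardinal.mk B) * Cardinal.lift.{u} (Cardinal.mk K) =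
      Cardinal.lift.{u} (Cardinal.mk K) :=
    Cardinal.mul_eq_right (by simp) (Cardinal.lift_mk_le'.2 ⟨f⟩) (by simp)
  rw [← Cardinal.lift_mk_eq', Cardinal.mk_prod, h]
  simp

/-- Over every vertex one puts the same infinite set `K`, so large that the points over the range
of any edge are equinumerous with `K`, and that `K` can be split into as many copies of itself as
a vertex emits edges. -/
theorem exists_branchingSystem {V : Type u} {E : Type v} (G : Ultragraph V E) :
    ∃ X : Type (max u v), Nonempty (BranchingSystem G X) := by
  classical
  let K : Type (max u v) := V ⊕ E ⊕ ℕ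
  have : Infinite K := inferInstanceAs (Infinite (V ⊕ E ⊕ ℕ))
  have hg (e : E) : Nonempty (G.range e × K ≃ K) :=
    have := (G.range_nonempty e).to_subtype
    nonempty_prod_equiv_of_embedding
      ((Function.Embedding.subtype _).trans Function.Embedding.inl)
  have hh (v : V) (hv : Nonempty {e : E // G.source e = v}) :
      Nonempty ({e : E // G.source e = v} × K ≃ K) :=
    nonempty_prod_equiv_of_embedding ((Function.Embedding.subtype _).trans
      (Function.Embedding.inl.trans Function.Embedding.inr))
  let g (e : E) := (hg e).some
  let h (v : V) (hv) := (hh v hv).some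
  let ins (e : E) (p : V × K) : V × K :=
    if hp : p.1 ∈ G.range e then
      (G.source e, h (G.source e) ⟨⟨e, rfl⟩⟩ (⟨e, rfl⟩, g e (⟨p.1, hp⟩, p.2)))
    else p
  -- The base point `v` is kept as a variable so that edges with a common source can be compared.
  have hins {e : E} {p : V × K} (hp : p.1 ∈ G.range e) (v : V)
      (hv : Nonempty {e : E // G.source e = v}) (he : G.source e = v) :
      ins e p = (v, h v hv (⟨e, he⟩, g e (⟨p.1, hp⟩, p.2))) := by
    subst he; exact dif_pos hp
  refine ⟨V × K, ⟨⟨Prod.fst, fun v => ⟨(v, Classical.arbitrary K), rfl⟩, ins, ?_, ?_, ?_⟩⟩⟩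
  · rintro e f ⟨v, x⟩ ⟨w, y⟩ hp hq heq
    have hs : G.source f = G.source e := by
      rw [hins hp _ ⟨⟨e, rfl⟩⟩ rfl, hins hq _ ⟨⟨f, rfl⟩⟩ rfl] at heq
      exact (congrArg Prod.fst heq).symm
    rw [hins hp _ ⟨⟨e, rfl⟩⟩ rfl, hins hq _ ⟨⟨e, rfl⟩⟩ hs] at heq
    have heq := (h (G.source e) ⟨⟨e, rfl⟩⟩).injective (congrArg Prod.snd heq)
    obtain rfl : e = f := congrArg (fun z => z.1.1) heq
    have := (g e).injective (congrArg Prod.snd heq)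
    simpa using this
  · intro e p hp
    rw [hins hp _ ⟨⟨e, rfl⟩⟩ rfl]
  · rintro e ⟨v, x⟩ hv
    obtain rfl : v = G.source e := hv
    obtain ⟨⟨⟨f, hf⟩, y⟩, rfl⟩ := (h (G.source e) ⟨⟨e, rfl⟩⟩).surjective x
    obtain ⟨⟨w, z⟩, rfl⟩ := (g f).surjective y
    exact ⟨f, (w.1, z), w.2, hins (p := (w.1, z)) w.2 _ ⟨⟨e, rfl⟩⟩ hf⟩

namespace BranchingSystem

variable {V : Type*} {E : Type*} {G : Ultragraph V E} {X : Type*} (B : BranchingSystem G X)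
  (R : Type*) [CommRing R]

open Classical in
/-- The operator of the edge `e` on functions on `X × ℤ`; the factor `ℤ` records degrees. -/
noncomputable def edgeOp (e : E) : Module.End R (X × ℤ → R) where
  toFun f p := if h : ∃ q, B.vertex q ∈ G.range e ∧ B.ins e q = p.1 then f (h.choose, p.2 - 1)
    else 0
  map_add' f g := by
    ext p; by_cases h : ∃ q, B.vertex q ∈ G.range e ∧ B.ins e q = p.1 <;> simp [h]
  map_smul' r f := by
    ext p; by_cases h : ∃ q, B.vertex q ∈ G.range e ∧ B.ins e q = p.1 <;> simp [h]

open Classical in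
/-- The operator of the ghost edge of `e`. -/
noncomputable def ghostOp (e : E) : Module.End R (X × ℤ → R) where
  toFun f p := if B.vertex p.1 ∈ G.range e then f (B.ins e p.1, p.2 + 1) else 0
  map_add' f g := by ext p; by_cases h : B.vertex p.1 ∈ G.range e <;> simp [h]
  map_smul' r f := by ext p; by_cases h : B.vertex p.1 ∈ G.range e <;> simp [h]

open Classical in
/-- The operator of a set `A` of vertices: restriction to the points over `A`. -/
noncomputable def projOp (A : Set V) : Module.End R (X × ℤ → R) where
  toFun f p := if B.vertex p.1 ∈ A then f p else 0
  map_add' f g := by ext p; by_cases h : B.vertex p.1 ∈ A <;> simp [h]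
  map_smul' r f := by ext p; by_cases h : B.vertex p.1 ∈ A <;> simp [h]

variable {R}

theorem edgeOp_ins {e : E} {q : X} (hq : B.vertex q ∈ G.range e) (f : X × ℤ → R) (k : ℤ) :
    B.edgeOp R e f (B.ins e q, k) = f (q, k - 1) := by
  have h : ∃ q', B.vertex q' ∈ G.range e ∧ B.ins e q' = B.ins e q := ⟨q, hq, rfl⟩
  have h₁ : h.choose = q := (B.ins_inj h.choose_spec.1 hq h.choose_spec.2).2
  exact (dif_pos h).trans (by rw [h₁])

theorem edgeOp_of_not {e : E} {p : X} (h : ¬∃ q, B.vertex q ∈ G.range e ∧ B.ins e q = p)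
    (f : X × ℤ → R) (k : ℤ) : B.edgeOp R e f (p, k) = 0 :=
  dif_neg h

theorem ghostOp_of_mem {e : E} {p : X} (h : B.vertex p ∈ G.range e) (f : X × ℤ → R) (k : ℤ) :
    B.ghostOp R e f (p, k) = f (B.ins e p, k + 1) :=
  if_pos h

theorem ghostOp_of_notMem {e : E} {p : X} (h : B.vertex p ∉ G.range e) (f : X × ℤ → R) (k : ℤ) :
    B.ghostOp R e f (p, k) = 0 :=
  if_neg h

theorem projOp_of_mem {A : Set V} {p : X} (h : B.vertex p ∈ A) (f : X × ℤ → R) (k : ℤ) :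
    B.projOp R A f (p, k) = f (p, k) :=
  if_pos h

theorem projOp_of_notMem {A : Set V} {p : X} (h : B.vertex p ∉ A) (f : X × ℤ → R) (k : ℤ) :
    B.projOp R A f (p, k) = 0 :=
  if_neg h

theorem edgeOp_ghostOp_ins {e : E} {q : X} (hq : B.vertex q ∈ G.range e) (f : X × ℤ → R) (k : ℤ) :
    B.edgeOp R e (B.ghostOp R e f) (B.ins e q, k) = f (B.ins e q, k) := by
  rw [B.edgeOp_ins hq, B.ghostOp_of_mem hq, sub_add_cancel]

variable (R)

/-- The operators of a branching system satisfy the Leavitt relations. -/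
noncomputable def leavittFamily : LeavittFamily G (Module.End R (X × ℤ → R)) where
  S := B.edgeOp R
  T := B.ghostOp R
  P A _ := B.projOp R A
  P_empty := by ext f p; simp [projOp]
  P_mul A C _ _ := by
    refine LinearMap.ext fun f => funext fun ⟨p, k⟩ => ?_
    by_cases hA : B.vertex p ∈ A <;> by_cases hC : B.vertex p ∈ C <;> simp [projOp, hA, hC]
  P_union A C _ _ := by
    refine LinearMap.ext fun f => funext fun ⟨p, k⟩ => ?_
    by_cases hA : B.vertex p ∈ A <;> by_cases hC : B.vertex p ∈ C <;> simp [projOp, hA, hC]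
  P_source_mul_S e := by
    refine LinearMap.ext fun f => funext fun ⟨p, k⟩ => ?_
    rw [Module.End.mul_apply]
    by_cases h : ∃ q, B.vertex q ∈ G.range e ∧ B.ins e q = p
    · obtain ⟨q, hq, rfl⟩ := h
      rw [B.projOp_of_mem (B.vertex_ins hq)]
    · rw [B.edgeOp_of_not h]
      by_cases hp : B.vertex p ∈ ({G.source e} : Set V)
      · rw [B.projOp_of_mem hp, B.edgeOp_of_not h]
      · rw [B.projOp_of_notMem hp]
  S_mul_P_range e := by
    refine LinearMap.ext fun f => funext fun ⟨p, k⟩ => ?_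
    rw [Module.End.mul_apply]
    by_cases h : ∃ q, B.vertex q ∈ G.range e ∧ B.ins e q = p
    · obtain ⟨q, hq, rfl⟩ := h
      rw [B.edgeOp_ins hq, B.edgeOp_ins hq, B.projOp_of_mem hq]
    · rw [B.edgeOp_of_not h, B.edgeOp_of_not h]
  P_range_mul_T e := by
    refine LinearMap.ext fun f => funext fun ⟨p, k⟩ => ?_
    rw [Module.End.mul_apply]
    by_cases h : B.vertex p ∈ G.range e
    · rw [B.projOp_of_mem h]
    · rw [B.projOp_of_notMem h, B.ghostOp_of_notMem h]
  T_mul_P_source e := by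
    refine LinearMap.ext fun f => funext fun ⟨p, k⟩ => ?_
    rw [Module.End.mul_apply]
    by_cases h : B.vertex p ∈ G.range e
    · rw [B.ghostOp_of_mem h, B.ghostOp_of_mem h, B.projOp_of_mem (B.vertex_ins h)]
    · rw [B.ghostOp_of_notMem h, B.ghostOp_of_notMem h]
  T_mul_S_self e := by
    refine LinearMap.ext fun f => funext fun ⟨p, k⟩ => ?_
    rw [Module.End.mul_apply]
    by_cases h : B.vertex p ∈ G.range e
    · rw [B.ghostOp_of_mem h, B.edgeOp_ins h, B.projOp_of_mem h, add_sub_cancel_right]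
    · rw [B.ghostOp_of_notMem h, B.projOp_of_notMem h]
  T_mul_S_of_ne e f hef := by
    refine LinearMap.ext fun g => funext fun ⟨p, k⟩ => ?_
    rw [Module.End.mul_apply]
    by_cases h : B.vertex p ∈ G.range e
    · rw [B.ghostOp_of_mem h, B.edgeOp_of_not]
      · rfl
      · rintro ⟨q, hq, hqp⟩
        exact hef (B.ins_inj hq h hqp).1.symm
    · rw [B.ghostOp_of_notMem h]
      rfl
  vertex_sum v hfin hne := by
    refine LinearMap.ext fun g => funext fun ⟨p, k⟩ => ?_
    rw [LinearMap.sum_apply, Finset.sum_apply]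
    simp only [Module.End.mul_apply]
    by_cases h : B.vertex p = v
    · obtain ⟨e₀, he₀⟩ := hne
      obtain ⟨e, q, hq, rfl⟩ := B.exists_ins (h.trans (Eq.symm he₀))
      have hev : G.source e = v := (B.vertex_ins hq).symm.trans h
      rw [B.projOp_of_mem (show B.vertex (B.ins e q) ∈ ({v} : Set V) from h),
        Finset.sum_eq_single_of_mem e (by simpa using hev), B.edgeOp_ghostOp_ins hq]
      intro f _ hfe
      rw [B.edgeOp_of_not]
      rintro ⟨q', hq', heq⟩
      exact hfe (B.ins_inj hq' hq heq).1
    · rw [B.projOp_of_notMem (show B.vertex p ∉ ({v} : Set V) from h), Finset.sum_eq_zero]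
      intro e he
      rw [B.edgeOp_of_not]
      rintro ⟨q, hq, rfl⟩
      exact h ((B.vertex_ins hq).trans (by simpa using he))

end BranchingSystem

variable (R : Type*) [CommRing R]

/-- The functions on `X × ℤ` that vanish in all degrees greater than `k`. -/
def degreeLE (X : Type*) (k : ℤ) : Submodule R (X × ℤ → R) where
  carrier := {f | ∀ p j, k < j → f (p, j) = 0}
  zero_mem' _ _ _ := rfl
  add_mem' hf hg p j hj := by simp [hf p j hj, hg p j hj]
  smul_mem' r f hf p j hj := by simp [hf p j hj]

theorem degreeLE_mono (X : Type*) : Monotone (degreeLE R X) := fun _ _ hkl _ hf p j hj =>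
  hf p j (hkl.trans_lt hj)

/-- The operators on functions on `X × ℤ` that raise degrees by at most `i`. -/
def raiseLE (X : Type*) (i : ℤ) : Submodule R (Module.End R (X × ℤ → R)) where
  carrier := {T | ∀ k, ∀ f ∈ degreeLE R X k, T f ∈ degreeLE R X (k + i)}
  zero_mem' _ _ _ := zero_mem _
  add_mem' hS hT k f hf := add_mem (hS k f hf) (hT k f hf)
  smul_mem' r _ hT k f hf := Submodule.smul_mem _ r (hT k f hf)

/-- A representation that sends the generators to the operators of a branching system pulls the
filtration by degree back to the algebra. -/
noncomputable def BranchingSystem.degreeFiltration {V : Type*} {E : Type*} {G : Ultragraph V E}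
    {X : Type*} (B : BranchingSystem G X) {U : Type*} [Ring U] [Algebra R U]
    (L : LeavittFamily G U) (π : U →ₐ[R] Module.End R (X × ℤ → R))
    (hS : ∀ e, π (L.S e) = B.edgeOp R e) (hT : ∀ e, π (L.T e) = B.ghostOp R e)
    (hP : ∀ A hA, π (L.P A hA) = B.projOp R A) : L.DegreeFiltration R where
  F i := (raiseLE R X i).comap π.toLinearMap
  mono i j hij x hx k f hf := degreeLE_mono R X (by omega) (hx k f hf)
  one_mem k f hf := by simpa using hf
  mul_le i j := by
    rw [Submodule.mul_le]
    intro x hx y hy k f hf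
    have := hx _ _ (hy k f hf)
    rw [show k + (i + j) = k + j + i by ring]
    simpa using this
  S_mem e := by
    rw [Submodule.mem_comap, AlgHom.toLinearMap_apply, hS]
    intro k f hf p j hj
    by_cases h : ∃ q, B.vertex q ∈ G.range e ∧ B.ins e q = p
    · obtain ⟨q, hq, rfl⟩ := h
      rw [B.edgeOp_ins hq]
      exact hf _ _ (by omega)
    · exact B.edgeOp_of_not h _ _
  T_mem e := by
    rw [Submodule.mem_comap, AlgHom.toLinearMap_apply, hT]
    intro k f hf p j hj
    by_cases h : B.vertex p ∈ G.range e
    · rw [B.ghostOp_of_mem h]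
      exact hf _ _ (by omega)
    · exact B.ghostOp_of_notMem h _ _
  P_mem A hA := by
    rw [Submodule.mem_comap, AlgHom.toLinearMap_apply, hP]
    intro k f hf p j hj
    by_cases h : B.vertex p ∈ A
    · rw [B.projOp_of_mem h]
      exact hf _ _ (by omega)
    · exact B.projOp_of_notMem h _ _
  eq_zero_of_smul_pv_mem v r h := by
    classical
    obtain ⟨x, rfl⟩ := B.vertex_surjective v
    rw [Submodule.mem_comap, AlgHom.toLinearMap_apply, map_smul, LeavittFamily.pv, hP] at h
    have h₁ : (Pi.single (x, 0) 1 : X × ℤ → R) ∈ degreeLE R X 0 := fun p j hj =>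
      Pi.single_eq_of_ne (by rintro ⟨⟩; exact hj.false) _
    have h₂ := h 0 _ h₁ x 0 (by norm_num)
    rw [LinearMap.smul_apply, Pi.smul_apply, B.projOp_of_mem (Set.mem_singleton _),
      Pi.single_eq_same, smul_eq_mul, mul_one] at h₂
    exact h₂

/-! ### The universal property and the unitization -/

section Lift

variable {V : Type*} {E : Type*} {G : Ultragraph V E} {U : Type*} [Ring U] [Algebra R U]
  (L : LeavittFamily G U)

/-- The homomorphism from the free algebra given by a Leavitt family. -/
noncomputable def LeavittFamily.freeLift : FreeAlg R G →ₙₐ[R] U :=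
  MonoidAlgebra.liftMagma R (FreeSemigroup.lift fun x => match x with
    | .edge e => L.S e
    | .ghost e => L.T e
    | .proj A hA => L.P A hA)

theorem LeavittFamily.freeLift_freeS (e : E) : L.freeLift R (freeS R G e) = L.S e := by
  simp [freeLift, freeS, gen]

theorem LeavittFamily.freeLift_freeSStar (e : E) : L.freeLift R (freeSStar R G e) = L.T e := by
  simp [freeLift, freeSStar, gen]

theorem LeavittFamily.freeLift_freeP (A : Set V) (hA : G.IsGeneralizedVertex A) :
    L.freeLift R (freeP R G A hA) = L.P A hA := by
  simp [freeLift, freeP, gen]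

theorem LeavittFamily.freeLift_eq_of_rel {a b : FreeAlg R G} (h : Rel R G a b) :
    L.freeLift R a = L.freeLift R b := by
  induction h with
  | proj_empty => rw [freeLift_freeP, map_zero, L.P_empty]
  | proj_mul A B hA hB => simp only [map_mul, freeLift_freeP, L.P_mul]
  | proj_union A B hA hB => simp only [map_add, map_sub, freeLift_freeP, L.P_union A B hA hB]
  | source_edge e => simp only [map_mul, freeLift_freeP, freeLift_freeS, L.P_source_mul_S]
  | edge_range e => simp only [map_mul, freeLift_freeP, freeLift_freeS, L.S_mul_P_range]
  | range_ghost e => simp only [map_mul, freeLift_freeP, freeLift_freeSStar, L.P_range_mul_T]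
  | ghost_source e => simp only [map_mul, freeLift_freeP, freeLift_freeSStar, L.T_mul_P_source]
  | ghost_edge_same e =>
    simp only [map_mul, freeLift_freeP, freeLift_freeS, freeLift_freeSStar, L.T_mul_S_self]
  | ghost_edge_ne e f hef =>
    simp only [map_mul, map_zero, freeLift_freeS, freeLift_freeSStar, L.T_mul_S_of_ne e f hef]
  | vertex_sum x hfin hne =>
    simp only [map_sum, map_mul, freeLift_freeP, freeLift_freeS, freeLift_freeSStar,
      L.vertex_sum x hfin hne]

theorem LeavittFamily.freeLift_eq_of_leavittCon {a b : FreeAlg R G} (h : leavittCon R G a b) :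
    L.freeLift R a = L.freeLift R b := by
  change RingConGen.Rel (ScaledRel R G) a b at h
  induction h with
  | of x y h =>
    obtain ⟨r, h⟩ := h
    rw [map_smul, map_smul, L.freeLift_eq_of_rel R h]
  | refl x => rfl
  | symm _ ih => exact ih.symm
  | trans _ _ ih₁ ih₂ => exact ih₁.trans ih₂
  | add _ _ ih₁ ih₂ => rw [map_add, map_add, ih₁, ih₂]
  | mul _ _ ih₁ ih₂ => rw [map_mul, map_mul, ih₁, ih₂]

/-- The homomorphism from the Leavitt path algebra given by a Leavitt family. -/
noncomputable def LeavittFamily.lift : LeavittPathAlgebra R G →ₙₐ[R] U where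
  toFun := Quotient.lift (L.freeLift R) fun _ _ h => L.freeLift_eq_of_leavittCon R h
  map_smul' r x := by
    obtain ⟨a, rfl⟩ := leavittMk_surjective R G x
    exact map_smul (L.freeLift R) r a
  map_zero' := map_zero (L.freeLift R)
  map_add' x y := by
    obtain ⟨a, rfl⟩ := leavittMk_surjective R G x
    obtain ⟨b, rfl⟩ := leavittMk_surjective R G y
    exact map_add (L.freeLift R) a b
  map_mul' x y := by
    obtain ⟨a, rfl⟩ := leavittMk_surjective R G x
    obtain ⟨b, rfl⟩ := leavittMk_surjective R G y
    exact map_mul (L.freeLift R) a b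

end Lift

variable {V : Type*} {E : Type*} (G : Ultragraph V E)

/-- The quotient map as a homomorphism of non-unital algebras. -/
noncomputable def leavittMkHom : FreeAlg R G →ₙₐ[R] LeavittPathAlgebra R G where
  toFun := leavittMk R G
  map_smul' _ _ := rfl
  map_zero' := rfl
  map_add' _ _ := rfl
  map_mul' _ _ := rfl

/-- The map from the free algebra to the unitization of the Leavitt path algebra. -/
noncomputable def unitMk : FreeAlg R G →ₙₐ[R] Unitization R (LeavittPathAlgebra R G) :=
  (Unitization.inrNonUnitalAlgHom R _).comp (leavittMkHom R G)

variable {R G} in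
theorem unitMk_eq_of_rel {a b : FreeAlg R G} (h : Rel R G a b) :
    unitMk R G a = unitMk R G b := by
  have h₁ : leavittCon R G a b := by
    change RingConGen.Rel (ScaledRel R G) a b
    simpa using RingConGen.Rel.of _ _ (ScaledRel.mk (1 : R) h)
  exact congrArg (Unitization.inrNonUnitalAlgHom R (LeavittPathAlgebra R G))
    (Quotient.sound h₁ : leavittMk R G a = leavittMk R G b)

/-- The generators of the Leavitt path algebra inside its unitization. -/
noncomputable def universalFamily :
    LeavittFamily G (Unitization R (LeavittPathAlgebra R G)) where
  S e := unitMk R G (freeS R G e)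
  T e := unitMk R G (freeSStar R G e)
  P A hA := unitMk R G (freeP R G A hA)
  P_empty := by rw [unitMk_eq_of_rel .proj_empty, map_zero]
  P_mul A B hA hB := by rw [← map_mul, unitMk_eq_of_rel (.proj_mul A B hA hB)]
  P_union A B hA hB := by rw [unitMk_eq_of_rel (.proj_union A B hA hB), map_sub, map_add]
  P_source_mul_S e := by rw [← map_mul, unitMk_eq_of_rel (.source_edge e)]
  S_mul_P_range e := by rw [← map_mul, unitMk_eq_of_rel (.edge_range e)]
  P_range_mul_T e := by rw [← map_mul, unitMk_eq_of_rel (.range_ghost e)]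
  T_mul_P_source e := by rw [← map_mul, unitMk_eq_of_rel (.ghost_source e)]
  T_mul_S_self e := by rw [← map_mul, unitMk_eq_of_rel (.ghost_edge_same e)]
  T_mul_S_of_ne e f hef := by rw [← map_mul, unitMk_eq_of_rel (.ghost_edge_ne e f hef), map_zero]
  vertex_sum x hfin hne := by
    simp only [unitMk_eq_of_rel (.vertex_sum x hfin hne), map_sum, map_mul]

/-- The elements `s_α p_A s_β^*` span the Leavitt path algebra: their span contains the generators
and is stable under left multiplication by each of them. -/
theorem unitMk_mem_iSup_block (a : FreeAlg R G) :
    unitMk R G a ∈ ⨆ (k : ℕ) (l : ℕ), (universalFamily R G).block R k l := by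
  set L := universalFamily R G with hL
  set Y := ⨆ (k : ℕ) (l : ℕ), L.block R k l with hY
  have hle (k l : ℕ) : L.block R k l ≤ Y := le_iSup₂ (f := fun k l => L.block R k l) k l
  have hstable (x : G.Generator) : ∀ y ∈ Y, unitMk R G (gen R G x) * y ∈ Y := by
    suffices h : Y ≤ Y.comap (LinearMap.mulLeft R (unitMk R G (gen R G x))) from h
    refine iSup₂_le fun k l y hy => ?_
    rw [Submodule.mem_comap, LinearMap.mulLeft_apply]
    cases x with
    | edge e =>
      refine hle (k + 1) l ?_
      rw [LeavittFamily.block_succ_left]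
      exact Submodule.mul_mem_mul (L.S_mem R e) hy
    | ghost e =>
      cases k with
      | zero => exact hle 0 (l + 1) (L.spanT_mul_block_zero R l
          (Submodule.mul_mem_mul (L.T_mem R e) hy))
      | succ k => exact hle k l (L.spanT_mul_block_succ R k l
          (Submodule.mul_mem_mul (L.T_mem R e) hy))
    | proj A hA =>
      exact hle k l (L.spanP_mul_block R k l (Submodule.mul_mem_mul (L.P_mem R hA) hy))
  have hgen (x : G.Generator) : unitMk R G (gen R G x) ∈ Y := by
    cases x with
    | edge e =>
      refine hle 1 0 ?_
      rw [LeavittFamily.block_zero_right, pow_one]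
      exact L.spanS_le R (L.S_mem R e)
    | ghost e =>
      refine hle 0 1 ?_
      rw [LeavittFamily.block, pow_zero, one_mul, pow_one]
      exact L.spanT_le R (L.T_mem R e)
    | proj A hA =>
      refine hle 0 0 ?_
      rw [LeavittFamily.block_zero_right, pow_zero, one_mul]
      exact L.P_mem R hA
  have hword (w : FreeSemigroup G.Generator) : unitMk R G (MonoidAlgebra.single w 1) ∈ Y := by
    induction w using FreeSemigroup.recOnMul with
    | ih1 x => exact hgen x
    | ih2 x w _ ih =>
      have : (MonoidAlgebra.single (FreeSemigroup.of x * w) 1 : FreeAlg R G) =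
          gen R G x * MonoidAlgebra.single w 1 := by
        rw [gen, MonoidAlgebra.single_mul_single, one_mul]
      rw [this, map_mul]
      exact hstable x _ ih
  induction a using MonoidAlgebra.induction_linear with
  | zero => rw [map_zero]; exact zero_mem _
  | add a b ha hb => rw [map_add]; exact add_mem ha hb
  | single w r =>
    have : (MonoidAlgebra.single w r : FreeAlg R G) = r • MonoidAlgebra.single w 1 := by
      rw [MonoidAlgebra.smul_single, smul_eq_mul, mul_one]
    rw [this, map_smul]
    exact Submodule.smul_mem _ _ (hword w)

/-- The universal family carries a degree filtration. -/
theorem nonempty_degreeFiltration_universalFamily :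
    Nonempty ((universalFamily R G).DegreeFiltration R) := by
  obtain ⟨X, ⟨B⟩⟩ := exists_branchingSystem G
  let L := B.leavittFamily R
  refine ⟨B.degreeFiltration R (universalFamily R G) (Unitization.lift (L.lift R)) ?_ ?_ ?_⟩
  · intro e
    exact (by simp [unitMk] : Unitization.lift (L.lift R) (unitMk R G (freeS R G e)) =
      L.lift R (leavittMkHom R G (freeS R G e))).trans (L.freeLift_freeS R e)
  · intro e
    exact (by simp [unitMk] : Unitization.lift (L.lift R) (unitMk R G (freeSStar R G e)) =
      L.lift R (leavittMkHom R G (freeSStar R G e))).trans (L.freeLift_freeSStar R e)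
  · intro A hA
    exact (by simp [unitMk] : Unitization.lift (L.lift R) (unitMk R G (freeP R G A hA)) =
      L.lift R (leavittMkHom R G (freeP R G A hA))).trans (L.freeLift_freeP R A hA)

end Ultragraph

/-! ### Semiprimeness -/

theorem mainTheorem2 {V : Type*} {E : Type*} (G : Ultragraph V E)
    (R : Type*) [CommRing R] [NoZeroDivisors R] :
    IsSemiprimeRing (Ultragraph.LeavittPathAlgebra R G) := by
  intro I hI
  have hmul : ∀ x ∈ I, ∀ y ∈ I, x * y = 0 := by
    intro x hx y hy
    have : x * y ∈ I.productSubgroup I := AddSubgroup.subset_closure ⟨x, hx, y, hy, rfl⟩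
    rwa [hI, AddSubgroup.mem_bot] at this
  refine le_bot_iff.1 fun x hx => ?_
  rw [TwoSidedIdeal.mem_bot]
  obtain ⟨D⟩ := Ultragraph.nonempty_degreeFiltration_universalFamily R G
  obtain ⟨a, rfl⟩ := Ultragraph.leavittMk_surjective R G x
  set x := Ultragraph.leavittMk R G a
  have hx0 : Ultragraph.unitMk R G a = 0 := by
    refine D.eq_zero_of_forall_mul_mul_eq_zero (Ultragraph.unitMk_mem_iSup_block R G a) fun u => ?_
    change (x : Unitization R (Ultragraph.LeavittPathAlgebra R G)) * u * x = 0
    induction u using Unitization.ind with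
    | inl_add_inr r z =>
      -- The scalar part of `u` contributes `r • (x * x)`.
      rw [mul_add, add_mul, Unitization.inr_mul_inl, ← Unitization.inr_mul, ← Unitization.inr_mul,
        ← Unitization.inr_mul, smul_mul_assoc, hmul x hx x hx, smul_zero,
        hmul (x * z) (I.mul_mem_right _ _ hx) x hx, Unitization.inr_zero, add_zero]
  exact Unitization.inr_injective (hx0.trans (Unitization.inr_zero R).symm)
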